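/- For $q,s\in\mathbb C$ with $|q|<1$ let $L_q(s)=\sum_{n\ge 1} n^{s}\,\dfrac{q^{n}}{1-q^{n}}$ be the Lambert series, let $B_n$ be the Bernoulli numbers and $\delta_{jk}$ the Kronecker delta, and put $$b_{jk}(a)=a^{2k}+a^{-2k}-a^{2k+1-2j}-a^{-2k-1+2j},\qquad c_{jk}(a)=\frac{a^{2k-1}+a^{-2k+1}-a^{2k-2j}-a^{-2k+2j}}{1+\delta_{jk}} .$$ Let $a,t\in\mathbb C$ with $\operatorname{Re}(a)>0$, and suppose that $\operatorname{Re}(t)$, $\operatorname{Re}(at)$ and $\operatorname{Re}(t/a)$ are positive (so that all Lambert series below converge); $\log$ is the principal logarithm. (1) For every integer $k\ge 0$ (that is, $s=-(4k+1)=-1,-5,-9,\dots$), $$\begin{aligned} &\frac{1}{t^{2k}}\Big[a^{2k}L_{e^{-2\pi t/a}}(-4k-1)-(a^{2k}+a^{-2k})L_{e^{-2\pi t}}(-4k-1)+a^{-2k}L_{e^{-2\pi at}}(-4k-1)\Big]\\ &-t^{2k}\Big[a^{2k}L_{e^{-2\pi/(at)}}(-4k-1)-(a^{2k}+a^{-2k})L_{e^{-2\pi/t}}(-4k-1)+a^{-2k}L_{e^{-2\pi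 a/t}}(-4k-1)\Big]\\ &=(2\pi)^{4k+1}\sum_{j=0}^{k}\frac{(-1)^{j}\,b_{jk}(a)\,B_{2j}\,B_{4k+2-2j}\,\sinh[(2k+1-2j)\log t]}{(2j)!\,(4k+2-2j)!}. \end{aligned}$$ (2) For every integer $k\ge 1$ (that is, $s=-(4k-1)=-3,-7,-11,\dots$), $$\begin{aligned} &\frac{1}{t^{2k-1}}\Big[a^{2k-1}L_{e^{-2\pi t/a}}(-4k+1)-(a^{2k-1}+a^{-2k+1})L_{e^{-2\pi t}}(-4k+1)+a^{-2k+1}L_{e^{-2\pi at}}(-4k+1)\Big]\\ &+t^{2k-1}\Big[a^{2k-1}L_{e^{-2\pi/(at)}}(-4k+1)-(a^{2k-1}+a^{-2k+1})L_{e^{-2\pi/t}}(-4k+1)+a^{-2k+1}L_{e^{-2\pi a/t}}(-4k+1)\Big]\\ &=(2\pi)^{4k-1}\sum_{j=0}^{k}\frac{(-1)^{j}\,c_{jk}(a)\,B_{2j}\,B_{4k-2j}\,\cosh[(2k-2j)\log t]}{(2j)!\,(4k-2j)!}. \end{aligned}$$ Moreover, the following formulas for odd powers of $\pi$ hold: $$\begin{aligned}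 \pi&=72\,L_{e^{-\pi}}(-1)-96\,L_{e^{-2\pi}}(-1)+24\,L_{e^{-4\pi}}(-1),\\ \pi^5&=7056\,L_{e^{-\pi}}(-5)-6993\,L_{e^{-2\pi}}(-5)-63\,L_{e^{-4\pi}}(-5),\\ \pi^9&=\tfrac{28226880}{41}L_{e^{-\pi}}(-9)-\tfrac{112920885}{164}L_{e^{-2\pi}}(-9)+\tfrac{13365}{164}L_{e^{-4\pi}}(-9),\\ \pi^3&=720\,L_{e^{-\pi}}(-3)-900\,L_{e^{-2\pi}}(-3)+180\,L_{e^{-4\pi}}(-3),\\ \pi^7&=\tfrac{907200}{13}L_{e^{-\pi}}(-7)-70875\,L_{e^{-2\pi}}(-7)+\tfrac{14175}{13}L_{e^{-4\pi}}(-7),\\ \pi^{11}&=\tfrac{27243216000}{4009}L_{e^{-\pi}}(-11)-\tfrac{218158565625}{32072}L_{e^{-2\pi}}(-11)+\tfrac{212837625}{32072}L_{e^{-4\pi}}(-11). \end{aligned}$$ -/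

import Mathlib

/-- The Lambert series `L_q(s) = ∑_{n ≥ 1} n ^ s * q ^ n / (1 - q ^ n)`, for complex `s` and a
complex `q` with `‖q‖ < 1`. The summation index is shifted by one. -/
noncomputable def lambertL (q s : ℂ) : ℂ :=
  ∑' n : ℕ, ((n + 1 : ℕ) : ℂ) ^ s * q ^ (n + 1) / (1 - q ^ (n + 1))

/-- The series that defines `lambertL` converges (absolutely) for `‖q‖ < 1` and every `s`, so the
value of `lambertL` is then the genuine sum of the series. -/
theorem lambertL_summable {q : ℂ} (hq : ‖q‖ < 1) (s : ℂ) :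
    Summable fun n : ℕ => ((n + 1 : ℕ) : ℂ) ^ s * q ^ (n + 1) / (1 - q ^ (n + 1)) := by
  obtain ⟨K, hK⟩ := exists_nat_ge s.re
  have h1 : Summable fun n : ℕ => ((n : ℝ) ^ K * ‖q‖ ^ n : ℝ) :=
    summable_pow_mul_geometric_of_norm_lt_one K (by simpa using hq)
  have h2 := ((summable_nat_add_iff 1).2 h1).mul_right (1 - ‖q‖)⁻¹
  refine Summable.of_norm_bounded h2 fun n => ?_
  have hpos : (0 : ℝ) < ((n + 1 : ℕ) : ℝ) := by positivity
  have hone : (1 : ℝ) ≤ ((n + 1 : ℕ) : ℝ) := by exact_mod_cast Nat.succ_le_succ (Nat.zero_le n)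
  have hqn : ‖q‖ ^ (n + 1) ≤ ‖q‖ := pow_le_of_le_one (norm_nonneg q) hq.le (Nat.succ_ne_zero n)
  have hden : 1 - ‖q‖ ≤ ‖1 - q ^ (n + 1)‖ := by
    have h := norm_sub_norm_le (1 : ℂ) (q ^ (n + 1))
    rw [norm_one, norm_pow] at h
    linarith
  have hnum : ‖((n + 1 : ℕ) : ℂ) ^ s‖ ≤ ((n + 1 : ℕ) : ℝ) ^ K := by
    rw [Complex.norm_natCast_cpow_of_pos (Nat.succ_pos n), ← Real.rpow_natCast]
    exact Real.rpow_le_rpow_of_exponent_le hone hK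
  rw [norm_div, norm_mul, norm_pow, div_eq_mul_inv]
  have h0 : 0 < 1 - ‖q‖ := by linarith
  gcongr

/-- `b_{jk}(a) = a^{2k} + a^{-2k} - a^{2k+1-2j} - a^{-2k-1+2j}` (integer exponents). -/
noncomputable def bCoeff (j k : ℕ) (a : ℂ) : ℂ :=
  a ^ (2 * (k : ℤ)) + a ^ (-2 * (k : ℤ))
    - a ^ (2 * (k : ℤ) + 1 - 2 * (j : ℤ)) - a ^ (-2 * (k : ℤ) - 1 + 2 * (j : ℤ))

/-- `c_{jk}(a) = (a^{2k-1} + a^{-2k+1} - a^{2k-2j} - a^{-2k+2j}) / (1 + δ_{jk})`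
(integer exponents), where `δ_{jk}` is the Kronecker delta. -/
noncomputable def cCoeff (j k : ℕ) (a : ℂ) : ℂ :=
  (a ^ (2 * (k : ℤ) - 1) + a ^ (-2 * (k : ℤ) + 1)
    - a ^ (2 * (k : ℤ) - 2 * (j : ℤ)) - a ^ (-2 * (k : ℤ) + 2 * (j : ℤ)))
    / (1 + (if j = k then 1 else 0))

section

open Complex

/-! Everything rests on one inversion law `t ↔ 1/t` for `L` at exponent `-(2n+1)`. For `n ≥ 1` this
is Ramanujan's formula for `ζ(2n+1)`. The partial fractions of the cotangent turn `L` into zeta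
values plus the double series `quadSeries` (`lambertL_add_zeta`). Swapping its two summation
variables relates its values at `t` and `1/t`, up to products of even zeta values
(`quadSeries_sub`). For `n = 0` absolute convergence fails. Instead the transformation of the
Eisenstein series `G2` is integrated, which produces `log t / 2` (`lambertL_neg_one_sub`).

The unwanted terms, `ζ(2n+1)` or the logarithm, cancel when the laws at `t/a` and `a t` are added
and `a^n + a^{-n}` times the law at `t` is subtracted (`transformation_combination`). Even `n = 2k`
gives (1), odd `n = 2k - 1` gives (2), after pairing the terms `i` and `n + 1 - i`.

For `π^3, π^7, π^11` take `a = 2`, `t = 1` in (2). At `t = 1` law (1) reads `0 = 0`, so `π, π^5,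
π^9` come from the inversion law at `t = 2` and `t = 1 + i`, eliminating `log 2` or `ζ(2n+1)`. -/

/-! ### The double series and its behaviour under `t ↔ 1/t` -/

theorem exists_mul_le_norm_mul_sq_add {t : ℂ} (ht : 0 < t.re) :
    ∃ c : ℝ, 0 < c ∧ ∀ x y : ℝ, 0 ≤ x → 0 ≤ y → c * y ≤ ‖(x : ℂ) * t ^ 2 + y‖ := by
  by_cases him : t.im = 0
  · refine ⟨1, one_pos, fun x y hx hy => ?_⟩
    refine le_trans ?_ (Complex.re_le_norm _)
    simp only [pow_two, add_re, mul_re, ofReal_re, ofReal_im, him]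
    have := mul_nonneg hx (mul_self_nonneg t.re)
    linarith
  · have him2 : (t ^ 2).im ≠ 0 := by
      simp only [pow_two, mul_im]
      have := mul_ne_zero ht.ne' him
      intro h
      apply this
      linarith
    have hw : 0 < ‖t ^ 2‖ := norm_pos_iff.2 fun h => him2 (by simp [h])
    -- The constant is `|sin (arg t²)|`, the distance from `1` to the line `ℝ t²`. Multiplying by
    -- the conjugate of `t²` removes `x` from the imaginary part.
    refine ⟨|(t ^ 2).im| / ‖t ^ 2‖, by positivity, fun x y hx hy => ?_⟩
    rw [div_mul_eq_mul_div, div_le_iff₀ hw]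
    have h := Complex.abs_im_le_norm (((x : ℂ) * t ^ 2 + y) * (starRingEnd ℂ) (t ^ 2))
    have e : (((x : ℂ) * t ^ 2 + y) * (starRingEnd ℂ) (t ^ 2)).im = -(y * (t ^ 2).im) := by
      generalize t ^ 2 = w
      simp
      ring
    rwa [e, abs_neg, abs_mul, abs_of_nonneg hy, norm_mul, RCLike.norm_conj, mul_comm y] at h

theorem natCast_sq_mul_sq_add_ne_zero {t : ℂ} (ht : 0 < t.re) (m n : ℕ) :
    ((m + 1 : ℕ) : ℂ) ^ 2 * t ^ 2 + ((n + 1 : ℕ) : ℂ) ^ 2 ≠ 0 := by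
  obtain ⟨c, hc, h⟩ := exists_mul_le_norm_mul_sq_add ht
  have := h (((m + 1 : ℕ) : ℝ) ^ 2) (((n + 1 : ℕ) : ℝ) ^ 2) (by positivity) (by positivity)
  rw [← norm_pos_iff]
  push_cast at this ⊢
  exact lt_of_lt_of_le (by positivity) this

theorem hasSum_one_div_succ_pow {k : ℕ} (hk : 1 < k) :
    HasSum (fun n : ℕ => 1 / ((n + 1 : ℕ) : ℂ) ^ k) (riemannZeta k) := by
  have h1 : Summable fun n : ℕ => 1 / ((n : ℕ) : ℂ) ^ k := by
    have := (Complex.summable_one_div_nat_cpow (p := (k : ℂ))).2 (by simpa using hk)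
    simpa using this
  have h2 := (summable_nat_add_iff 1).2 h1
  rw [show riemannZeta k = ∑' n : ℕ, 1 / ((n + 1 : ℕ) : ℂ) ^ k from ?_]
  · exact h2.hasSum
  have := zeta_eq_tsum_one_div_nat_add_one_cpow (s := (k : ℂ)) (by simpa using hk)
  simpa using this

/-- The double series `∑ 1 / (m ^ (2 n) (m ^ 2 t ^ 2 + l ^ 2))` over `m, l ≥ 1`. -/
noncomputable def quadSeries (n : ℕ) (t : ℂ) : ℂ :=
  ∑' p : ℕ × ℕ, 1 / ((((p.1 + 1 : ℕ) : ℂ) ^ 2) ^ n *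
    (((p.1 + 1 : ℕ) : ℂ) ^ 2 * t ^ 2 + ((p.2 + 1 : ℕ) : ℂ) ^ 2))

theorem summable_quadSeries {n : ℕ} (hn : 1 ≤ n) {t : ℂ} (ht : 0 < t.re) :
    Summable fun p : ℕ × ℕ => 1 / ((((p.1 + 1 : ℕ) : ℂ) ^ 2) ^ n *
      (((p.1 + 1 : ℕ) : ℂ) ^ 2 * t ^ 2 + ((p.2 + 1 : ℕ) : ℂ) ^ 2)) := by
  obtain ⟨c, hc, h⟩ := exists_mul_le_norm_mul_sq_add ht
  have hs : Summable fun m : ℕ => 1 / ((m + 1 : ℕ) : ℝ) ^ 2 :=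
    (summable_nat_add_iff 1).2 (Real.summable_one_div_nat_pow.2 one_lt_two)
  have hp := (hs.mul_of_nonneg hs (fun _ => by positivity) (fun _ => by positivity)).mul_left c⁻¹
  refine Summable.of_norm_bounded hp fun p => ?_
  have h1 := h (((p.1 + 1 : ℕ) : ℝ) ^ 2) (((p.2 + 1 : ℕ) : ℝ) ^ 2) (by positivity) (by positivity)
  have h2 : ((p.1 + 1 : ℕ) : ℝ) ^ 2 ≤ (((p.1 + 1 : ℕ) : ℝ) ^ 2) ^ n :=
    le_self_pow₀ (one_le_pow₀ (by exact_mod_cast Nat.succ_le_succ (Nat.zero_le _))) (by omega)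
  rw [norm_div, norm_one, norm_mul, norm_pow, norm_pow, Complex.norm_natCast]
  rw [show c⁻¹ * (1 / ((p.1 + 1 : ℕ) : ℝ) ^ 2 * (1 / ((p.2 + 1 : ℕ) : ℝ) ^ 2)) =
    1 / (((p.1 + 1 : ℕ) : ℝ) ^ 2 * (c * ((p.2 + 1 : ℕ) : ℝ) ^ 2)) by field_simp]
  have h3 : c * ((p.2 + 1 : ℕ) : ℝ) ^ 2 ≤
      ‖((p.1 + 1 : ℕ) : ℂ) ^ 2 * t ^ 2 + ((p.2 + 1 : ℕ) : ℂ) ^ 2‖ := by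
    simpa using h1
  gcongr

theorem hasSum_mul_prod {f g : ℕ → ℂ} {x y : ℂ} (hf : HasSum f x) (hg : HasSum g y) :
    HasSum (fun p : ℕ × ℕ => f p.1 * g p.2) (x * y) := by
  have h := summable_mul_of_summable_norm hf.summable.norm hg.summable.norm
  rw [← hf.tsum_eq, ← hg.tsum_eq,
    tsum_mul_tsum_of_summable_norm hf.summable.norm hg.summable.norm]
  exact h.hasSum

/-- Iterates `1/(u(uw+v)) = 1/(uv) - w/(v(uw+v))`, which trades a factor `1/u` for `-w/v`. With `u =
m²`, `v = l²`, `w = t²` the finite sum separates the variables. -/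
theorem one_div_pow_mul_eq_sum {u v w : ℂ} (hu : u ≠ 0) (hv : v ≠ 0) (hd : u * w + v ≠ 0) (n : ℕ) :
    1 / (u ^ n * (u * w + v)) = ∑ j ∈ Finset.range n, (-w) ^ j * (1 / u ^ (n - j) * (1 / v ^ (j + 1)))
      + (-w) ^ n * (1 / (v ^ n * (u * w + v))) := by
  induction n with
  | zero => simp
  | succ n ih =>
    have e : 1 / (u ^ (n + 1) * (u * w + v)) = 1 / u * (1 / (u ^ n * (u * w + v))) := by
      rw [one_div_mul_one_div, pow_succ']
      ring
    rw [e, ih, Finset.sum_range_succ, mul_add, Finset.mul_sum, add_assoc]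
    congr 1
    · refine Finset.sum_congr rfl fun j hj => ?_
      rw [Nat.succ_sub (Finset.mem_range.1 hj).le]
      simp only [Nat.succ_eq_add_one, pow_succ']
      field_simp
    · rw [show n + 1 - n = 1 by omega]
      field_simp
      ring

theorem inv_re_pos {t : ℂ} (ht : 0 < t.re) : 0 < (t⁻¹).re := by
  rw [Complex.inv_re]
  have : t ≠ 0 := fun h => by simp [h] at ht
  exact div_pos ht (normSq_pos.2 this)

theorem quadSeries_sub {n : ℕ} (hn : 1 ≤ n) {t : ℂ} (ht : 0 < t.re) :
    quadSeries n t - (-t ^ 2) ^ n * ((t ^ 2)⁻¹ * quadSeries n t⁻¹) =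
      ∑ j ∈ Finset.range n, (-t ^ 2) ^ j *
        (riemannZeta (2 * (n - j) : ℕ) * riemannZeta (2 * (j + 1) : ℕ)) := by
  have ht0 : t ≠ 0 := fun h => by simp [h] at ht
  have h1 := (summable_quadSeries hn ht).hasSum
  have h2 := (summable_quadSeries hn (inv_re_pos ht)).hasSum
  -- Swapping `m` and `l` matches the remainder term, since `m² t² + l² = t² (l² t⁻² + m²)`.
  rw [← (Equiv.prodComm ℕ ℕ).hasSum_iff] at h2
  have h3 := (h2.mul_left (t ^ 2)⁻¹).mul_left ((-t ^ 2) ^ n)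
  have h4 : HasSum (fun p : ℕ × ℕ => ∑ j ∈ Finset.range n, (-t ^ 2) ^ j *
      (1 / (((p.1 + 1 : ℕ) : ℂ)) ^ (2 * (n - j)) * (1 / (((p.2 + 1 : ℕ) : ℂ)) ^ (2 * (j + 1)))))
      (∑ j ∈ Finset.range n, (-t ^ 2) ^ j *
        (riemannZeta (2 * (n - j) : ℕ) * riemannZeta (2 * (j + 1) : ℕ))) := by
    refine hasSum_sum fun j hj => HasSum.mul_left _ ?_
    have a := hasSum_one_div_succ_pow (k := 2 * (n - j)) (by have := Finset.mem_range.1 hj; omega)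
    have b := hasSum_one_div_succ_pow (k := 2 * (j + 1)) (by omega)
    have c := hasSum_mul_prod a b
    exact c
  refine (h1.sub h3).unique (h4.congr_fun ?_)
  intro p
  have hd := natCast_sq_mul_sq_add_ne_zero ht p.1 p.2
  have e := one_div_pow_mul_eq_sum (u := ((p.1 + 1 : ℕ) : ℂ) ^ 2) (v := ((p.2 + 1 : ℕ) : ℂ) ^ 2)
    (w := t ^ 2) (pow_ne_zero _ (Nat.cast_ne_zero.2 (Nat.succ_ne_zero _)))
    (pow_ne_zero _ (Nat.cast_ne_zero.2 (Nat.succ_ne_zero _))) hd n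
  simp only [← pow_mul] at e ⊢
  rw [e, add_sub_assoc, add_eq_left, ← mul_sub, mul_eq_zero]
  right
  rw [sub_eq_zero]
  simp only [Function.comp, Equiv.prodComm_apply, Prod.fst_swap, Prod.snd_swap]
  rw [one_div, one_div, ← mul_inv]
  congr 1
  field_simp
  ring

/-! ### Lambert series through the cotangent expansion -/

theorem norm_exp_neg_two_pi_mul_lt_one {x : ℂ} (hx : 0 < x.re) :
    ‖exp (-(2 * Real.pi * x))‖ < 1 := by
  rw [Complex.norm_exp, Real.exp_lt_one_iff]
  have : (-(2 * (Real.pi : ℂ) * x)).re = -(2 * Real.pi * x.re) := by simp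
  rw [this]
  have := Real.pi_pos
  have : 0 < 2 * Real.pi * x.re := by positivity
  linarith

theorem one_sub_exp_ne_zero {x : ℂ} (hx : 0 < x.re) : 1 - exp (-(2 * Real.pi * x)) ≠ 0 := by
  intro h
  have := norm_exp_neg_two_pi_mul_lt_one hx
  rw [← sub_eq_zero.1 h, norm_one] at this
  exact lt_irrefl _ this

/-- The partial fraction expansion of `π cot (π z)` at `z = i x`. -/
theorem exp_div_one_sub_exp_eq {x : ℂ} (hx : 0 < x.re) :
    exp (-(2 * Real.pi * x)) / (1 - exp (-(2 * Real.pi * x))) =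
      1 / (2 * Real.pi * x) - 1 / 2 +
        x / Real.pi * ∑' m : ℕ, 1 / (x ^ 2 + ((m + 1 : ℕ) : ℂ) ^ 2) := by
  have hx0 : x ≠ 0 := fun h => by simp [h] at hx
  have hpi : (Real.pi : ℂ) ≠ 0 := Complex.ofReal_ne_zero.2 Real.pi_ne_zero
  have him : 0 < (I * x).im := by simpa using hx
  have hc : I * x ∈ Complex.integerComplement :=
    UpperHalfPlane.coe_mem_integerComplement ⟨I * x, him⟩
  have h := cot_series_rep' hc
  rw [Complex.cot_pi_eq_exp_ratio] at h
  have e1 : exp (2 * Real.pi * I * (I * x)) = exp (-(2 * Real.pi * x)) := by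
    congr 1
    linear_combination 2 * Real.pi * x * I_mul_I
  have e2 : ∀ m : ℕ, 1 / (I * x - (m + 1)) + 1 / (I * x + (m + 1)) =
      (-(2 * I * x)) * (1 / (x ^ 2 + ((m + 1 : ℕ) : ℂ) ^ 2)) := by
    intro m
    have h1 : I * x - (m + 1) ≠ 0 := by
      have := Complex.integerComplement_add_ne_zero hc (-((m : ℤ) + 1))
      push_cast at this
      rwa [sub_eq_add_neg]
    have h2 : I * x + (m + 1) ≠ 0 := by
      have := Complex.integerComplement_add_ne_zero hc ((m : ℤ) + 1)
      push_cast at this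
      exact this
    have h3 : x ^ 2 + ((m + 1 : ℕ) : ℂ) ^ 2 = -((I * x - (m + 1)) * (I * x + (m + 1))) := by
      push_cast
      linear_combination x ^ 2 * I_mul_I
    rw [h3]
    field_simp
    ring
  rw [e1, tsum_congr e2, tsum_mul_left] at h
  have hq := one_sub_exp_ne_zero hx
  generalize exp (-(2 * Real.pi * x)) = q at *
  generalize (∑' m : ℕ, 1 / (x ^ 2 + ((m + 1 : ℕ) : ℂ) ^ 2)) = S at *
  have h' : (Real.pi : ℂ) * (q + 1) * x - (1 - q) = (2 * x ^ 2) * S * (1 - q) := by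
    field_simp at h
    linear_combination h - 2 * S * x ^ 2 * (1 - q) * I_sq
  field_simp
  linear_combination h'

theorem lambertL_summand_eq (n N : ℕ) (t : ℂ) :
    ((N + 1 : ℕ) : ℂ) ^ (-(2 * (n : ℂ) + 1)) * exp (-(2 * Real.pi * t)) ^ (N + 1) /
      (1 - exp (-(2 * Real.pi * t)) ^ (N + 1)) =
    1 / ((N + 1 : ℕ) : ℂ) ^ (2 * n + 1) * (exp (-(2 * Real.pi * (((N + 1 : ℕ) : ℂ) * t))) /
      (1 - exp (-(2 * Real.pi * (((N + 1 : ℕ) : ℂ) * t))))) := by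
  rw [← Complex.exp_nat_mul, Complex.cpow_neg,
    show (2 * (n : ℂ) + 1) = ((2 * n + 1 : ℕ) : ℂ) by push_cast; ring, Complex.cpow_natCast,
    show ((N + 1 : ℕ) : ℂ) * -(2 * Real.pi * t) = -(2 * Real.pi * (((N + 1 : ℕ) : ℂ) * t)) by ring]
  ring

/-- Expand each summand at `x = N t`, divide by `N^(2n+1)` and sum over `N`: the constant `-1/2`
yields `ζ(2n+1)/2`, the pole term yields `ζ(2n+2)`. -/
theorem lambertL_add_zeta {n : ℕ} (hn : 1 ≤ n) {t : ℂ} (ht : 0 < t.re) :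
    lambertL (exp (-(2 * Real.pi * t))) (-(2 * (n : ℂ) + 1)) + riemannZeta (2 * n + 1 : ℕ) / 2 =
      riemannZeta (2 * (n + 1) : ℕ) / (2 * Real.pi * t) + t / Real.pi * quadSeries n t := by
  have ht0 : t ≠ 0 := fun h => by simp [h] at ht
  have hpi : (Real.pi : ℂ) ≠ 0 := Complex.ofReal_ne_zero.2 Real.pi_ne_zero
  have h1 := (lambertL_summable (norm_exp_neg_two_pi_mul_lt_one ht) (-(2 * (n : ℂ) + 1))).hasSum
  have h2 := (hasSum_one_div_succ_pow (k := 2 * n + 1) (by omega)).div_const 2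
  have h3 := (hasSum_one_div_succ_pow (k := 2 * (n + 1)) (by omega)).div_const (2 * Real.pi * t)
  have hq := summable_quadSeries hn ht
  have h4 := (hq.hasSum.prod_fiberwise fun N => (hq.prod_factor N).hasSum).mul_left (t / Real.pi)
  refine (h1.add h2).unique ((h3.add h4).congr_fun fun N => ?_)
  have hN : ((N + 1 : ℕ) : ℂ) ≠ 0 := Nat.cast_ne_zero.2 (Nat.succ_ne_zero _)
  have hre : 0 < (((N + 1 : ℕ) : ℂ) * t).re := by
    rw [← Complex.ofReal_natCast, Complex.re_ofReal_mul]
    positivity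
  rw [lambertL_summand_eq, exp_div_one_sub_exp_eq hre]
  have e : ∀ m : ℕ, 1 / ((((N + 1 : ℕ) : ℂ) ^ 2) ^ n *
      (((N + 1 : ℕ) : ℂ) ^ 2 * t ^ 2 + ((m + 1 : ℕ) : ℂ) ^ 2)) =
      1 / ((((N + 1 : ℕ) : ℂ) ^ 2) ^ n) *
        (1 / ((((N + 1 : ℕ) : ℂ) * t) ^ 2 + ((m + 1 : ℕ) : ℂ) ^ 2)) := by
    intro m
    rw [one_div_mul_one_div, mul_pow]
  rw [tsum_congr e, tsum_mul_left]
  generalize (∑' m : ℕ, 1 / ((((N + 1 : ℕ) : ℂ) * t) ^ 2 + ((m + 1 : ℕ) : ℂ) ^ 2)) = S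
  generalize ((N + 1 : ℕ) : ℂ) = M at *
  field_simp
  ring

/-! ### The exponent `-1`, by integrating the transformation of `G2` -/

/-- Expand `x/(1-x)² = ∑ c x^c` and collect equal exponents. Termwise differentiation produces the
left side, the `q`-expansion of `G2` the right. -/
theorem tsum_div_one_sub_sq_eq_tsum_sigma {q : ℂ} (hq : ‖q‖ < 1) :
    ∑' N : ℕ, q ^ (N + 1) / (1 - q ^ (N + 1)) ^ 2 =
      ∑' e : ℕ+, (ArithmeticFunction.sigma 1 e : ℂ) * q ^ (e : ℕ) := by
  rw [← tsum_prod_pow_eq_tsum_sigma 1 hq]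
  rw [tsum_pnat_eq_tsum_succ (f := fun d : ℕ => ∑' c : ℕ+, ((c : ℕ) : ℂ) ^ 1 * q ^ (d * c : ℕ))]
  refine tsum_congr fun N => ?_
  have hN : ‖q ^ (N + 1)‖ < 1 := by
    rw [norm_pow]
    exact pow_lt_one₀ (norm_nonneg _) hq (Nat.succ_ne_zero _)
  rw [← tsum_coe_mul_geometric_of_norm_lt_one hN,
    (summable_pow_mul_geometric_of_norm_lt_one 1 hN |>.congr fun n => by
      rw [pow_one] : Summable fun n : ℕ => (n : ℂ) * (q ^ (N + 1)) ^ n).tsum_eq_zero_add]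
  rw [tsum_pnat_eq_tsum_succ (f := fun c : ℕ => (c : ℂ) ^ 1 * q ^ ((N + 1) * c))]
  simp [pow_mul]

/-- `∑ σ₁(n) exp (-2 π n t)` over `n ≥ 1`. -/
noncomputable def sigmaSeries (t : ℂ) : ℂ :=
  ∑' e : ℕ+, (ArithmeticFunction.sigma 1 e : ℂ) * exp (-(2 * Real.pi * t)) ^ (e : ℕ)

/-- The transformation of `G2` under `S` at `z = i t`; its quasimodular correction is the term
`2π/t`, which later integrates to the logarithm. -/
theorem sigmaSeries_add_inv {t : ℂ} (ht : 0 < t.re) :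
    8 * (Real.pi : ℂ) ^ 2 * (sigmaSeries t + (t ^ 2)⁻¹ * sigmaSeries t⁻¹) =
      Real.pi ^ 2 / 3 * (1 + (t ^ 2)⁻¹) - 2 * Real.pi / t := by
  have ht0 : t ≠ 0 := fun h => by simp [h] at ht
  have him : 0 < (I * t).im := by simpa using ht
  have h := EisensteinSeries.G2_S_transform ⟨I * t, him⟩
  rw [EisensteinSeries.G2_eq_tsum_cexp, EisensteinSeries.G2_eq_tsum_cexp, riemannZeta_two] at h
  have e1 : ((UpperHalfPlane.mk (I * t) him : UpperHalfPlane) : ℂ) = I * t := rfl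
  have e2 : ((ModularGroup.S • (UpperHalfPlane.mk (I * t) him) : UpperHalfPlane) : ℂ) = I * t⁻¹ := by
    rw [UpperHalfPlane.modular_S_smul]
    change (-(I * t))⁻¹ = _
    rw [inv_neg, mul_inv, Complex.inv_I]
    ring
  rw [e1, e2] at h
  have e3 : ∀ s : ℂ, exp (2 * Real.pi * I * (I * s)) = exp (-(2 * Real.pi * s)) := by
    intro s
    congr 1
    linear_combination 2 * Real.pi * s * I_mul_I
  rw [e3, e3] at h
  unfold sigmaSeries
  generalize (∑' e : ℕ+, (ArithmeticFunction.sigma 1 e : ℂ) * exp (-(2 * Real.pi * t)) ^ (e : ℕ)) = X at *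
  generalize (∑' e : ℕ+, (ArithmeticFunction.sigma 1 e : ℂ) * exp (-(2 * Real.pi * t⁻¹)) ^ (e : ℕ)) = Y at *
  have e4 : ((I * t) ^ 2)⁻¹ = -(t ^ 2)⁻¹ := by
    rw [mul_pow, I_sq, neg_one_mul, inv_neg]
  have e5 : -2 * Real.pi * I / (I * t) = -(2 * Real.pi / t) := by
    field_simp
  rw [e4, e5] at h
  linear_combination -h

theorem hasDerivAt_lambertL_neg_one_term (N : ℕ) {s : ℂ} (hs : 0 < s.re) :
    HasDerivAt (fun s : ℂ => 1 / ((N + 1 : ℕ) : ℂ) *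
      (exp (-(2 * Real.pi * (((N + 1 : ℕ) : ℂ) * s))) /
      (1 - exp (-(2 * Real.pi * (((N + 1 : ℕ) : ℂ) * s))))))
      (-(2 * Real.pi) * (exp (-(2 * Real.pi * (((N + 1 : ℕ) : ℂ) * s))) /
      (1 - exp (-(2 * Real.pi * (((N + 1 : ℕ) : ℂ) * s)))) ^ 2)) s := by
  have hN : ((N + 1 : ℕ) : ℂ) ≠ 0 := Nat.cast_ne_zero.2 (Nat.succ_ne_zero _)
  have hre : 0 < (((N + 1 : ℕ) : ℂ) * s).re := by
    rw [← Complex.ofReal_natCast, Complex.re_ofReal_mul]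
    positivity
  have hq := one_sub_exp_ne_zero hre
  generalize ((N + 1 : ℕ) : ℂ) = M at *
  have d1 : HasDerivAt (fun s : ℂ => -(2 * Real.pi * (M * s))) (-(2 * Real.pi * M)) s := by
    refine ((hasDerivAt_id s).const_mul (-(2 * Real.pi * M))).congr_deriv (mul_one _) |>.congr_of_eventuallyEq
      (Filter.Eventually.of_forall fun s => ?_)
    simp only [id]
    ring
  have d2 := d1.cexp
  have d3 := (d2.div (d2.const_sub 1) hq).const_mul (1 / M)
  refine d3.congr_deriv ?_
  generalize exp (-(2 * Real.pi * (M * s))) = q at *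
  field_simp
  ring

theorem norm_deriv_lambertL_neg_one_term_le (N : ℕ) {s : ℂ} {x : ℝ} (hx : 0 < x) (hs : x < s.re) :
    ‖-(2 * Real.pi) * (exp (-(2 * Real.pi * (((N + 1 : ℕ) : ℂ) * s))) /
      (1 - exp (-(2 * Real.pi * (((N + 1 : ℕ) : ℂ) * s)))) ^ 2)‖ ≤
    2 * Real.pi * (Real.exp (-(2 * Real.pi * x)) ^ (N + 1) /
      (1 - Real.exp (-(2 * Real.pi * x))) ^ 2) := by
  have hr1 : Real.exp (-(2 * Real.pi * x)) < 1 := by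
    rw [Real.exp_lt_one_iff, neg_lt_zero]
    have := Real.pi_pos
    positivity
  have hr0 : 0 ≤ Real.exp (-(2 * Real.pi * x)) := (Real.exp_pos _).le
  have hqn : ‖exp (-(2 * Real.pi * (((N + 1 : ℕ) : ℂ) * s)))‖ ≤
      Real.exp (-(2 * Real.pi * x)) ^ (N + 1) := by
    rw [show -(2 * Real.pi * (((N + 1 : ℕ) : ℂ) * s)) =
      ((N + 1 : ℕ) : ℂ) * -(2 * Real.pi * s) by ring, Complex.exp_nat_mul, norm_pow]
    refine pow_le_pow_left₀ (norm_nonneg _) ?_ _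
    rw [Complex.norm_exp, Real.exp_le_exp]
    have : (-(2 * (Real.pi : ℂ) * s)).re = -(2 * Real.pi * s.re) := by simp
    rw [this]
    have := Real.pi_pos
    gcongr
  generalize Real.exp (-(2 * Real.pi * x)) = r at *
  generalize exp (-(2 * Real.pi * (((N + 1 : ℕ) : ℂ) * s))) = q at *
  have hrn : r ^ (N + 1) ≤ r := pow_le_of_le_one hr0 hr1.le (Nat.succ_ne_zero _)
  have hden : 1 - r ≤ ‖1 - q‖ := by
    have h := norm_sub_norm_le (1 : ℂ) q
    rw [norm_one] at h
    linarith
  have h0 : 0 < 1 - r := by linarith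
  have hpi := Real.pi_pos
  rw [norm_mul, norm_neg, norm_div, norm_pow, norm_mul, Complex.norm_real, Complex.norm_two,
    Real.norm_of_nonneg hpi.le]
  gcongr

theorem hasDerivAt_lambertL_neg_one {t : ℂ} (ht : 0 < t.re) :
    HasDerivAt (fun t : ℂ => lambertL (exp (-(2 * Real.pi * t))) (-1))
      (-(2 * Real.pi) * sigmaSeries t) t := by
  have hL : ∀ s : ℂ, lambertL (exp (-(2 * Real.pi * s))) (-1) =
      ∑' N : ℕ, 1 / ((N + 1 : ℕ) : ℂ) * (exp (-(2 * Real.pi * (((N + 1 : ℕ) : ℂ) * s))) /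
      (1 - exp (-(2 * Real.pi * (((N + 1 : ℕ) : ℂ) * s))))) := by
    intro s
    refine tsum_congr fun N => ?_
    have := lambertL_summand_eq 0 N s
    simpa using this
  have hsum : Summable fun N : ℕ => 1 / ((N + 1 : ℕ) : ℂ) *
      (exp (-(2 * Real.pi * (((N + 1 : ℕ) : ℂ) * t))) /
      (1 - exp (-(2 * Real.pi * (((N + 1 : ℕ) : ℂ) * t))))) := by
    refine (lambertL_summable (norm_exp_neg_two_pi_mul_lt_one ht) (-1)).congr fun N => ?_
    have := lambertL_summand_eq 0 N t
    simpa using this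
  rw [show (fun t : ℂ => lambertL (exp (-(2 * Real.pi * t))) (-1)) = _ from funext hL]
  -- On the half-plane `Re s > Re t / 2` the derivatives are dominated by a geometric series of
  -- ratio `r < 1`.
  set r : ℝ := Real.exp (-(2 * Real.pi * (t.re / 2))) with hr
  have hr1 : r < 1 := by
    rw [hr, Real.exp_lt_one_iff]
    have := Real.pi_pos
    have : 0 < 2 * Real.pi * (t.re / 2) := by positivity
    linarith
  have hr0 : 0 ≤ r := (Real.exp_pos _).le
  have hval : -(2 * Real.pi) * sigmaSeries t = ∑' N : ℕ, (-(2 * Real.pi)) *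
      (exp (-(2 * Real.pi * (((N + 1 : ℕ) : ℂ) * t))) /
      (1 - exp (-(2 * Real.pi * (((N + 1 : ℕ) : ℂ) * t)))) ^ 2) := by
    rw [sigmaSeries, ← tsum_div_one_sub_sq_eq_tsum_sigma (norm_exp_neg_two_pi_mul_lt_one ht),
      tsum_mul_left]
    congr 2
    ext N
    rw [← Complex.exp_nat_mul,
      show ((N + 1 : ℕ) : ℂ) * -(2 * Real.pi * t) = -(2 * Real.pi * (((N + 1 : ℕ) : ℂ) * t)) by ring]
  rw [hval]
  have hU : IsOpen {s : ℂ | t.re / 2 < s.re} := isOpen_lt continuous_const Complex.continuous_re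
  have hpre : IsPreconnected {s : ℂ | t.re / 2 < s.re} :=
    (convex_halfSpace_re_gt _).isPreconnected
  have hmem : t ∈ {s : ℂ | t.re / 2 < s.re} := by
    simp only [Set.mem_ofPred_eq]
    linarith
  have hu : Summable fun N : ℕ => 2 * Real.pi * (r ^ (N + 1) / (1 - r) ^ 2) :=
    (((summable_nat_add_iff 1).2 (summable_geometric_of_lt_one hr0 hr1)).div_const _).mul_left _
  exact hasDerivAt_tsum_of_isPreconnected hu hU hpre
    (fun N s hs => hasDerivAt_lambertL_neg_one_term N (lt_trans (half_pos ht) hs))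
    (fun N s hs => norm_deriv_lambertL_neg_one_term_le N (half_pos ht) hs) hmem hsum hmem

/-- Both sides have the same derivative on the right half-plane and vanish at `t = 1`. This is the
logarithm of the eta transformation. -/
theorem lambertL_neg_one_sub {t : ℂ} (ht : 0 < t.re) :
    lambertL (exp (-(2 * Real.pi * t))) (-1) - lambertL (exp (-(2 * Real.pi * t⁻¹))) (-1) =
      log t / 2 + Real.pi / 12 * (t⁻¹ - t) := by
  have hopen : IsOpen {s : ℂ | 0 < s.re} := isOpen_lt continuous_const Complex.continuous_re
  have hpre : IsPreconnected {s : ℂ | 0 < s.re} := (convex_halfSpace_re_gt _).isPreconnected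
  have hpi : (Real.pi : ℂ) ≠ 0 := Complex.ofReal_ne_zero.2 Real.pi_ne_zero
  have hd : ∀ s : ℂ, 0 < s.re → HasDerivAt (fun s : ℂ => lambertL (exp (-(2 * Real.pi * s))) (-1) -
      lambertL (exp (-(2 * Real.pi * s⁻¹))) (-1) - (log s / 2 + Real.pi / 12 * (s⁻¹ - s))) 0 s := by
    intro s hs
    have hs0 : s ≠ 0 := fun h => by simp [h] at hs
    have d1 := hasDerivAt_lambertL_neg_one hs
    have d2 := (hasDerivAt_lambertL_neg_one (inv_re_pos hs)).comp s (hasDerivAt_inv hs0)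
    have d3 := (hasDerivAt_log (Or.inl hs : s ∈ slitPlane)).div_const 2
    have d4 := ((hasDerivAt_inv hs0).sub (hasDerivAt_id s)).const_mul (Real.pi / 12 : ℂ)
    refine ((d1.sub d2).sub (d3.add d4)).congr_deriv ?_
    have h := sigmaSeries_add_inv hs
    have h' : 8 * (Real.pi : ℂ) * (sigmaSeries s + (s ^ 2)⁻¹ * sigmaSeries s⁻¹) =
      Real.pi / 3 * (1 + (s ^ 2)⁻¹) - 2 / s := by
      refine mul_left_cancel₀ hpi ?_
      linear_combination h
    linear_combination -h' / 4
  have hconst := hopen.is_const_of_deriv_eq_zero hpre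
    (fun s hs => (hd s hs).differentiableAt.differentiableWithinAt)
    (fun s hs => (hd s hs).deriv) (show t ∈ {s : ℂ | 0 < s.re} from ht)
    (show (1 : ℂ) ∈ {s : ℂ | 0 < s.re} by simp)
  simp only [inv_one, sub_self, log_one, zero_div, mul_zero, add_zero] at hconst
  exact sub_eq_zero.1 hconst

/-! ### Ramanujan's formula -/

/-- The coefficient `B_{2i} B_{2n+2-2i} / ((2i)! (2n+2-2i)!)`. -/
noncomputable def bernoulliProd (n i : ℕ) : ℂ :=
  (bernoulli (2 * i) : ℂ) * (bernoulli (2 * n + 2 - 2 * i) : ℂ) /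
    ((Nat.factorial (2 * i) : ℂ) * (Nat.factorial (2 * n + 2 - 2 * i) : ℂ))

/-- The finite sum in Ramanujan's formula for `ζ(2n+1)`. -/
noncomputable def ramanujanSum (n : ℕ) (t : ℂ) : ℂ :=
  (-1) ^ n * 2 ^ (2 * n) * (Real.pi : ℂ) ^ (2 * n + 1) *
    ∑ i ∈ Finset.range (n + 2), (-1) ^ i * bernoulliProd n i * t ^ (2 * (i : ℤ) - 1 - n)

/-- Euler's evaluation of `ζ(2i)`, in the form that also covers `ζ(0) = -1/2`, so the end terms need
no separate treatment. -/
theorem zeta_mul_zeta_eq {n i : ℕ} (hi : i ≤ n + 1) :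
    riemannZeta (2 * i : ℕ) * riemannZeta (2 * (n + 1 - i) : ℕ) =
      (-1) ^ (n + 1) * 2 ^ (2 * n) * (Real.pi : ℂ) ^ (2 * n + 2) * bernoulliProd n i := by
  obtain ⟨j, hj⟩ := Nat.exists_eq_add_of_le hi
  have e1 : n + 1 - i = j := by omega
  have e2 : 2 * n + 2 - 2 * i = 2 * j := by omega
  have h1 := riemannZeta_two_mul_nat' (k := i)
  have h2 := riemannZeta_two_mul_nat' (k := j)
  have p1 : (2 : ℂ) ^ (2 * n) = (2 : ℂ) ^ (2 * (i : ℤ) - 1) * (2 : ℂ) ^ (2 * (j : ℤ) - 1) := by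
    rw [← zpow_add₀ two_ne_zero, ← zpow_natCast]
    congr 1
    push_cast
    omega
  have p2 : (Real.pi : ℂ) ^ (2 * n + 2) = (Real.pi : ℂ) ^ (2 * i) * (Real.pi : ℂ) ^ (2 * j) := by
    rw [← pow_add]
    congr 1
    omega
  have p3 : (-1 : ℂ) ^ (n + 1) = (-1) ^ (i + 1) * (-1) ^ (j + 1) := by
    rw [hj]
    ring
  rw [bernoulliProd, e1, e2, p1, p2, p3]
  push_cast
  rw [h1, h2]
  ring

theorem ramanujanSum_eq_zeta (n : ℕ) (t : ℂ) :
    ramanujanSum n t = -(1 / Real.pi) * ∑ i ∈ Finset.range (n + 2), (-1) ^ i *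
      (riemannZeta (2 * i : ℕ) * riemannZeta (2 * (n + 1 - i) : ℕ)) * t ^ (2 * (i : ℤ) - 1 - n) := by
  have hpi : (Real.pi : ℂ) ≠ 0 := Complex.ofReal_ne_zero.2 Real.pi_ne_zero
  rw [ramanujanSum, Finset.mul_sum, Finset.mul_sum]
  refine Finset.sum_congr rfl fun i hi => ?_
  rw [zeta_mul_zeta_eq (by have := Finset.mem_range.1 hi; omega)]
  field_simp
  ring

/-- Ramanujan's formula for `ζ(2n+1)`. -/
theorem ramanujan_formula {n : ℕ} (hn : 1 ≤ n) {t : ℂ} (ht : 0 < t.re) :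
    (t ^ n)⁻¹ * (lambertL (exp (-(2 * Real.pi * t))) (-(2 * (n : ℂ) + 1)) +
        riemannZeta (2 * n + 1 : ℕ) / 2)
      - (-t) ^ n * (lambertL (exp (-(2 * Real.pi * t⁻¹))) (-(2 * (n : ℂ) + 1)) +
        riemannZeta (2 * n + 1 : ℕ) / 2) = ramanujanSum n t := by
  have ht0 : t ≠ 0 := fun h => by simp [h] at ht
  have hpi : (Real.pi : ℂ) ≠ 0 := Complex.ofReal_ne_zero.2 Real.pi_ne_zero
  -- Since `ζ(0) = -1/2`, the end terms `i = 0` and `i = n + 1` are the `ζ(2n+2)` terms at `t` and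
  -- `1/t`; the inner terms come from `quadSeries_sub`.
  rw [lambertL_add_zeta hn ht, lambertL_add_zeta hn (inv_re_pos ht), ramanujanSum_eq_zeta,
    Finset.sum_range_succ, Finset.sum_range_succ']
  have h := quadSeries_sub hn ht
  have hz : riemannZeta ((2 * 0 : ℕ) : ℂ) = -1 / 2 := by simp [riemannZeta_zero]
  have e : ∑ i ∈ Finset.range n, (-1) ^ (i + 1) *
      (riemannZeta (2 * (i + 1) : ℕ) * riemannZeta (2 * (n + 1 - (i + 1)) : ℕ)) *
        t ^ (2 * ((i + 1 : ℕ) : ℤ) - 1 - n) = -(t * (t ^ n)⁻¹) * ∑ j ∈ Finset.range n,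
        (-t ^ 2) ^ j * (riemannZeta (2 * (n - j) : ℕ) * riemannZeta (2 * (j + 1) : ℕ)) := by
    rw [Finset.mul_sum]
    refine Finset.sum_congr rfl fun j _ => ?_
    have e1 : t ^ (2 * ((j + 1 : ℕ) : ℤ) - 1 - n) = t * (t ^ n)⁻¹ * (t ^ 2) ^ j := by
      rw [show 2 * ((j + 1 : ℕ) : ℤ) - 1 - n = 1 + (2 * j : ℕ) - n by push_cast; ring,
        zpow_sub₀ ht0, zpow_add₀ ht0, zpow_natCast, zpow_natCast, zpow_one, pow_mul]
      ring
    rw [e1, show n + 1 - (j + 1) = n - j by omega, neg_pow (t ^ 2) j]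
    ring
  rw [e, ← h, show n + 1 - (n + 1) = 0 by omega, Nat.sub_zero, hz]
  have e2 : t ^ (2 * ((n + 1 : ℕ) : ℤ) - 1 - n) = t * t ^ n := by
    rw [show 2 * ((n + 1 : ℕ) : ℤ) - 1 - n = 1 + n by push_cast; ring, zpow_add₀ ht0,
      zpow_natCast, zpow_one]
  have e3 : t ^ (2 * ((0 : ℕ) : ℤ) - 1 - n) = t⁻¹ * (t ^ n)⁻¹ := by
    rw [show 2 * ((0 : ℕ) : ℤ) - 1 - n = -1 + -n by push_cast; ring, zpow_add₀ ht0,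
      zpow_neg, zpow_neg, zpow_natCast, zpow_one]
  have e4 : (-t ^ 2) ^ n = (-t) ^ n * t ^ n := by
    rw [← mul_pow]
    ring
  have e5 : (-t) ^ n = (-1) ^ n * t ^ n := neg_pow t n
  rw [e2, e3, e4, e5]
  generalize riemannZeta (2 * (n + 1) : ℕ) = Z
  generalize quadSeries n t = X
  generalize quadSeries n t⁻¹ = Y
  have htn : t ^ n ≠ 0 := pow_ne_zero _ ht0
  rw [pow_succ (-1 : ℂ) n]
  generalize t ^ n = T at *
  field_simp
  ring

/-- The error term in the transformation law cancels in the combination at `t / a`, `t`, `a t`. -/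
theorem exists_transformation (n : ℕ) : ∃ E : ℂ → ℂ,
    (∀ t : ℂ, 0 < t.re → (t ^ n)⁻¹ * lambertL (exp (-(2 * Real.pi * t))) (-(2 * (n : ℂ) + 1))
      - (-t) ^ n * lambertL (exp (-(2 * Real.pi * t⁻¹))) (-(2 * (n : ℂ) + 1)) =
        ramanujanSum n t + E t) ∧
    ∀ a t : ℂ, 0 < a.re → 0 < t.re → 0 < (a * t).re → 0 < (t / a).re →
      E (t / a) + E (a * t) = (a ^ n + (a ^ n)⁻¹) * E t := by
  rcases Nat.eq_zero_or_pos n with rfl | hn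
  · refine ⟨fun t => log t / 2, fun t ht => ?_, fun a t ha ht _ _ => ?_⟩
    · have h := lambertL_neg_one_sub ht
      have hr : ramanujanSum 0 t = Real.pi / 12 * (t⁻¹ - t) := by
        simp [ramanujanSum, bernoulliProd, Finset.sum_range_succ, bernoulli_two]
        ring
      rw [hr]
      simp only [pow_zero, inv_one, one_mul, Nat.cast_zero, mul_zero, zero_add]
      linear_combination h
    · have ha0 : a ≠ 0 := fun h => by simp [h] at ha
      have ht0 : t ≠ 0 := fun h => by simp [h] at ht
      -- Both arguments lie in `(-π/2, π/2)`, so the principal logarithm is additive on `a t` and `t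
      -- / a`.
      have a1 := abs_lt.1 (abs_arg_lt_pi_div_two_iff.2 (Or.inl ha))
      have a2 := abs_lt.1 (abs_arg_lt_pi_div_two_iff.2 (Or.inl ht))
      have l1 : log (a * t) = log a + log t :=
        (log_mul_eq_add_log_iff ha0 ht0).2 ⟨by linarith, by linarith⟩
      have l2 : log (t / a) = log t - log a := by
        have hne : a.arg ≠ Real.pi := by linarith [Real.pi_pos]
        rw [div_eq_mul_inv, (log_mul_eq_add_log_iff ht0 (inv_ne_zero ha0)).2, log_inv _ hne,
          sub_eq_add_neg]
        rw [arg_inv, if_neg hne]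
        exact ⟨by linarith, by linarith⟩
      simp only [l1, l2, pow_zero]
      ring
  -- Both `t^{-n}` and `t^n` satisfy `f(t/a) + f(a t) = (a^n + a^{-n}) f(t)`.
  · refine ⟨fun t => -(riemannZeta (2 * n + 1 : ℕ) / 2) * ((t ^ n)⁻¹ - (-t) ^ n),
      fun t ht => ?_, fun a t ha ht _ _ => ?_⟩
    · rw [← ramanujan_formula hn ht]
      ring
    · have ha0 : a ≠ 0 := fun h => by simp [h] at ha
      have ht0 : t ≠ 0 := fun h => by simp [h] at ht
      simp only [neg_pow t, neg_pow (t / a), neg_pow (a * t), div_pow, mul_pow]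
      have han : a ^ n ≠ 0 := pow_ne_zero _ ha0
      have htn : t ^ n ≠ 0 := pow_ne_zero _ ht0
      generalize a ^ n = A at *
      generalize t ^ n = T at *
      field_simp
      ring

theorem transformation_combination (n : ℕ) {a t : ℂ} (ha : 0 < a.re) (ht : 0 < t.re)
    (hat : 0 < (a * t).re) (hta : 0 < (t / a).re) :
    (t ^ n)⁻¹ * (a ^ n * lambertL (exp (-(2 * Real.pi * t / a))) (-(2 * (n : ℂ) + 1))
        - (a ^ n + (a ^ n)⁻¹) * lambertL (exp (-(2 * Real.pi * t))) (-(2 * (n : ℂ) + 1))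
        + (a ^ n)⁻¹ * lambertL (exp (-(2 * Real.pi * a * t))) (-(2 * (n : ℂ) + 1)))
      - (-1) ^ n * t ^ n * (a ^ n *
          lambertL (exp (-(2 * Real.pi / (a * t)))) (-(2 * (n : ℂ) + 1))
        - (a ^ n + (a ^ n)⁻¹) * lambertL (exp (-(2 * Real.pi / t))) (-(2 * (n : ℂ) + 1))
        + (a ^ n)⁻¹ * lambertL (exp (-(2 * Real.pi * a / t))) (-(2 * (n : ℂ) + 1))) =
    (-1) ^ n * 2 ^ (2 * n) * (Real.pi : ℂ) ^ (2 * n + 1) * ∑ i ∈ Finset.range (n + 2),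
      (-1) ^ i * bernoulliProd n i * (a ^ (2 * (i : ℤ) - 1 - n) + a ^ (-(2 * (i : ℤ) - 1 - n))
        - a ^ n - (a ^ n)⁻¹) * t ^ (2 * (i : ℤ) - 1 - n) := by
  have ha0 : a ≠ 0 := fun h => by simp [h] at ha
  have ht0 : t ≠ 0 := fun h => by simp [h] at ht
  obtain ⟨E, h1, h2⟩ := exists_transformation n
  have hE := h2 a t ha ht hat hta
  have e1 := h1 _ hta
  have e2 := h1 _ hat
  have e3 := h1 _ ht
  have r : ramanujanSum n (t / a) + ramanujanSum n (a * t) -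
      (a ^ n + (a ^ n)⁻¹) * ramanujanSum n t =
    (-1) ^ n * 2 ^ (2 * n) * (Real.pi : ℂ) ^ (2 * n + 1) * ∑ i ∈ Finset.range (n + 2),
      (-1) ^ i * bernoulliProd n i * (a ^ (2 * (i : ℤ) - 1 - n) + a ^ (-(2 * (i : ℤ) - 1 - n))
        - a ^ n - (a ^ n)⁻¹) * t ^ (2 * (i : ℤ) - 1 - n) := by
    simp only [ramanujanSum, Finset.mul_sum]
    rw [← Finset.sum_add_distrib, ← Finset.sum_sub_distrib]
    refine Finset.sum_congr rfl fun i _ => ?_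
    rw [div_zpow, mul_zpow, zpow_neg]
    ring
  rw [← r]
  have x1 : -(2 * Real.pi * t / a) = -(2 * Real.pi * (t / a)) := by ring
  have x2 : -(2 * Real.pi * a * t) = -(2 * Real.pi * (a * t)) := by ring
  have x3 : -(2 * Real.pi / (a * t)) = -(2 * Real.pi * (a * t)⁻¹) := by ring
  have x4 : -(2 * Real.pi / t) = -(2 * Real.pi * t⁻¹) := by ring
  have x5 : -(2 * Real.pi * a / t) = -(2 * Real.pi * (t / a)⁻¹) := by
    rw [inv_div]
    ring
  rw [x1, x2, x3, x4, x5]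
  have p1 : ((t / a) ^ n)⁻¹ = (t ^ n)⁻¹ * a ^ n := by rw [div_pow, inv_div, div_eq_mul_inv, mul_comm]
  have p2 : ((a * t) ^ n)⁻¹ = (t ^ n)⁻¹ * (a ^ n)⁻¹ := by rw [mul_pow, mul_inv, mul_comm]
  have p3 : (-(t / a)) ^ n = (-1) ^ n * t ^ n * (a ^ n)⁻¹ := by
    rw [neg_pow, div_pow, div_eq_mul_inv, mul_assoc]
  have p4 : (-(a * t)) ^ n = (-1) ^ n * t ^ n * a ^ n := by
    rw [neg_pow, mul_pow]
    ring
  have p5 : (-t) ^ n = (-1) ^ n * t ^ n := neg_pow t n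
  rw [p1, p3] at e1
  rw [p2, p4] at e2
  rw [p5] at e3
  linear_combination e1 + e2 - (a ^ n + (a ^ n)⁻¹) * e3 + hE

/-! ### Folding the sum: the two transformation laws -/

theorem bernoulliProd_reflect {n i : ℕ} (hi : i ≤ n + 1) :
    bernoulliProd n (n + 1 - i) = bernoulliProd n i := by
  rw [bernoulliProd, bernoulliProd, show 2 * n + 2 - 2 * (n + 1 - i) = 2 * i by omega,
    show 2 * (n + 1 - i) = 2 * n + 2 - 2 * i by omega, mul_comm (bernoulli (2 * n + 2 - 2 * i) : ℂ),
    mul_comm (Nat.factorial (2 * n + 2 - 2 * i) : ℂ)]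

theorem sinh_int_mul_log {t : ℂ} (ht : t ≠ 0) (m : ℤ) :
    sinh (m * log t) = (t ^ m - t ^ (-m)) / 2 := by
  rw [Complex.sinh, Complex.exp_int_mul, Complex.exp_log ht, ← neg_mul, ← Int.cast_neg,
    Complex.exp_int_mul, Complex.exp_log ht]

theorem cosh_int_mul_log {t : ℂ} (ht : t ≠ 0) (m : ℤ) :
    cosh (m * log t) = (t ^ m + t ^ (-m)) / 2 := by
  rw [Complex.cosh, Complex.exp_int_mul, Complex.exp_log ht, ← neg_mul, ← Int.cast_neg,
    Complex.exp_int_mul, Complex.exp_log ht]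

theorem sum_range_eq_sum_add_reflect {M : Type*} [AddCommMonoid M] (f : ℕ → M) (k : ℕ) :
    ∑ i ∈ Finset.range (2 * k), f i = ∑ i ∈ Finset.range k, (f i + f (2 * k - 1 - i)) := by
  rw [two_mul, Finset.sum_range_add, Finset.sum_add_distrib]
  congr 1
  rw [← Finset.sum_range_reflect]
  refine Finset.sum_congr rfl fun i hi => ?_
  congr 1
  have := Finset.mem_range.1 hi
  omega

theorem sum_range_eq_sum_add_reflect_add {M : Type*} [AddCommMonoid M] (f : ℕ → M) (k : ℕ) :
    ∑ i ∈ Finset.range (2 * k + 1), f i =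
      ∑ i ∈ Finset.range k, (f i + f (2 * k - i)) + f k := by
  rw [show 2 * k + 1 = k + 1 + k by omega, Finset.sum_range_add, Finset.sum_range_succ,
    Finset.sum_add_distrib, add_right_comm]
  congr 2
  rw [← Finset.sum_range_reflect]
  refine Finset.sum_congr rfl fun i hi => ?_
  congr 1
  have := Finset.mem_range.1 hi
  omega

/-- Case `n = 2k`: the `2k + 2` terms pair off as `i ↔ 2k + 1 - i` with opposite signs and inverse
powers of `t`, which gives the `sinh`. -/
theorem lambertL_transformation_even (k : ℕ) {a t : ℂ} (ha : 0 < a.re) (ht : 0 < t.re)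
    (hat : 0 < (a * t).re) (hta : 0 < (t / a).re) :
    1 / t ^ (2 * k) *
        (a ^ (2 * (k : ℤ)) *
            lambertL (Complex.exp (-(2 * Real.pi * t / a))) (-(4 * (k : ℂ) + 1))
          - (a ^ (2 * (k : ℤ)) + a ^ (-2 * (k : ℤ))) *
            lambertL (Complex.exp (-(2 * Real.pi * t))) (-(4 * (k : ℂ) + 1))
          + a ^ (-2 * (k : ℤ)) *
            lambertL (Complex.exp (-(2 * Real.pi * a * t))) (-(4 * (k : ℂ) + 1)))
      - t ^ (2 * k) *
        (a ^ (2 * (k : ℤ)) *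
            lambertL (Complex.exp (-(2 * Real.pi / (a * t)))) (-(4 * (k : ℂ) + 1))
          - (a ^ (2 * (k : ℤ)) + a ^ (-2 * (k : ℤ))) *
            lambertL (Complex.exp (-(2 * Real.pi / t))) (-(4 * (k : ℂ) + 1))
          + a ^ (-2 * (k : ℤ)) *
            lambertL (Complex.exp (-(2 * Real.pi * a / t))) (-(4 * (k : ℂ) + 1)))
    = (2 * Real.pi) ^ (4 * k + 1) *
        ∑ j ∈ Finset.range (k + 1),
          (-1) ^ j * bCoeff j k a * (bernoulli (2 * j) : ℂ) *
              (bernoulli (4 * k + 2 - 2 * j) : ℂ) *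
              Complex.sinh ((2 * (k : ℂ) + 1 - 2 * (j : ℂ)) * Complex.log t)
            / ((Nat.factorial (2 * j) : ℂ) * (Nat.factorial (4 * k + 2 - 2 * j) : ℂ)) := by
  have ht0 : t ≠ 0 := fun h => by simp [h] at ht
  have h := transformation_combination (2 * k) ha ht hat hta
  have z1 : a ^ (2 * (k : ℤ)) = a ^ (2 * k) := by exact_mod_cast zpow_natCast a (2 * k)
  have z2 : a ^ (-2 * (k : ℤ)) = (a ^ (2 * k))⁻¹ := by rw [neg_mul, zpow_neg, z1]
  have s1 : -(4 * (k : ℂ) + 1) = -(2 * ((2 * k : ℕ) : ℂ) + 1) := by push_cast; ring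
  have m1 : (-1 : ℂ) ^ (2 * k) = 1 := by simp [pow_mul]
  rw [z1, z2, s1, one_div]
  rw [m1, one_mul, one_mul] at h
  rw [h, show 2 * k + 2 = 2 * (k + 1) by ring, sum_range_eq_sum_add_reflect, Finset.mul_sum,
    Finset.mul_sum]
  refine Finset.sum_congr rfl fun j hj => ?_
  have hj' := Finset.mem_range.1 hj
  rw [show 2 * (k + 1) - 1 - j = 2 * k + 1 - j by omega,
    bernoulliProd_reflect (show j ≤ 2 * k + 1 by omega)]
  have c1 : ((2 * k + 1 - j : ℕ) : ℤ) = 2 * k + 1 - j := by omega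
  have c2 : (-1 : ℂ) ^ (2 * k + 1 - j) = -(-1) ^ j := by
    have : (-1 : ℂ) ^ (2 * k + 1 - j) * (-1) ^ j = -1 := by
      rw [← pow_add, show 2 * k + 1 - j + j = 2 * k + 1 by omega, pow_succ, m1, one_mul]
    have hsq : (-1 : ℂ) ^ j * (-1) ^ j = 1 := by rw [← mul_pow]; simp
    linear_combination (-1) ^ j * this - (-1) ^ (2 * k + 1 - j) * hsq
  rw [c1, c2, show 2 * (j : ℤ) - 1 - ((2 * k : ℕ) : ℤ) = -(2 * (k : ℤ) + 1 - 2 * j) by push_cast; ring,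
    show 2 * (2 * (k : ℤ) + 1 - j) - 1 - ((2 * k : ℕ) : ℤ) = 2 * (k : ℤ) + 1 - 2 * j by push_cast; ring,
    neg_neg, show (2 * (k : ℂ) + 1 - 2 * (j : ℂ)) = ((2 * (k : ℤ) + 1 - 2 * j : ℤ) : ℂ) by push_cast; ring,
    sinh_int_mul_log ht0, bCoeff, z1, z2,
    show -2 * (k : ℤ) - 1 + 2 * (j : ℤ) = -(2 * (k : ℤ) + 1 - 2 * j) by ring, bernoulliProd,
    show 2 * (2 * k) + 2 - 2 * j = 4 * k + 2 - 2 * j by omega,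
    show (2 * (Real.pi : ℂ)) ^ (4 * k + 1) = 2 * (2 ^ (2 * (2 * k)) * Real.pi ^ (2 * (2 * k) + 1)) by ring]
  ring

/-- Case `n = 2l + 1 = 2k - 1`: paired terms have equal signs, which gives the `cosh`. The middle
term `i = k` is its own partner, whence `1 + δ`. -/
theorem lambertL_transformation_odd (l : ℕ) {a t : ℂ} (ha : 0 < a.re) (ht : 0 < t.re)
    (hat : 0 < (a * t).re) (hta : 0 < (t / a).re) {k : ℕ} (hk : k = l + 1) :
    1 / t ^ (2 * k - 1) *
        (a ^ (2 * (k : ℤ) - 1) *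
            lambertL (Complex.exp (-(2 * Real.pi * t / a))) (-(4 * (k : ℂ) - 1))
          - (a ^ (2 * (k : ℤ) - 1) + a ^ (-2 * (k : ℤ) + 1)) *
            lambertL (Complex.exp (-(2 * Real.pi * t))) (-(4 * (k : ℂ) - 1))
          + a ^ (-2 * (k : ℤ) + 1) *
            lambertL (Complex.exp (-(2 * Real.pi * a * t))) (-(4 * (k : ℂ) - 1)))
      + t ^ (2 * k - 1) *
        (a ^ (2 * (k : ℤ) - 1) *
            lambertL (Complex.exp (-(2 * Real.pi / (a * t)))) (-(4 * (k : ℂ) - 1))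
          - (a ^ (2 * (k : ℤ) - 1) + a ^ (-2 * (k : ℤ) + 1)) *
            lambertL (Complex.exp (-(2 * Real.pi / t))) (-(4 * (k : ℂ) - 1))
          + a ^ (-2 * (k : ℤ) + 1) *
            lambertL (Complex.exp (-(2 * Real.pi * a / t))) (-(4 * (k : ℂ) - 1)))
    = (2 * Real.pi) ^ (4 * k - 1) *
        ∑ j ∈ Finset.range (k + 1),
          (-1) ^ j * cCoeff j k a * (bernoulli (2 * j) : ℂ) *
              (bernoulli (4 * k - 2 * j) : ℂ) *
              Complex.cosh ((2 * (k : ℂ) - 2 * (j : ℂ)) * Complex.log t)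
            / ((Nat.factorial (2 * j) : ℂ) * (Nat.factorial (4 * k - 2 * j) : ℂ)) := by
  have ht0 : t ≠ 0 := fun h => by simp [h] at ht
  have h := transformation_combination (2 * l + 1) ha ht hat hta
  have z1 : a ^ (2 * (k : ℤ) - 1) = a ^ (2 * l + 1) := by
    rw [← zpow_natCast]
    congr 1
    omega
  have z2 : a ^ (-2 * (k : ℤ) + 1) = (a ^ (2 * l + 1))⁻¹ := by
    rw [← z1, ← zpow_neg]
    congr 1
    ring
  have s1 : -(4 * (k : ℂ) - 1) = -(2 * ((2 * l + 1 : ℕ) : ℂ) + 1) := by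
    rw [hk]
    push_cast
    ring
  have m1 : (-1 : ℂ) ^ (2 * l + 1) = -1 := by simp [pow_succ, pow_mul]
  rw [z1, z2, s1, one_div, show 2 * k - 1 = 2 * l + 1 by omega]
  rw [m1, neg_one_mul, neg_mul, sub_neg_eq_add] at h
  rw [h, show 2 * l + 1 + 2 = 2 * k + 1 by omega, sum_range_eq_sum_add_reflect_add,
    Finset.sum_range_succ,
    mul_add (-1 * 2 ^ (2 * (2 * l + 1)) * (Real.pi : ℂ) ^ (2 * (2 * l + 1) + 1)),
    mul_add ((2 * (Real.pi : ℂ)) ^ (4 * k - 1))]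
  have hp : (2 * (Real.pi : ℂ)) ^ (4 * k - 1) =
      2 * (2 ^ (2 * (2 * l + 1)) * Real.pi ^ (2 * (2 * l + 1) + 1)) := by
    rw [show 4 * k - 1 = 2 * (2 * l + 1) + 1 by omega, mul_pow, pow_succ (2 : ℂ)]
    ring
  congr 1
  · rw [Finset.mul_sum, Finset.mul_sum]
    refine Finset.sum_congr rfl fun j hj => ?_
    have hj' := Finset.mem_range.1 hj
    have hr := bernoulliProd_reflect (n := 2 * l + 1) (i := j) (by omega)
    rw [show 2 * l + 1 + 1 - j = 2 * k - j by omega] at hr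
    rw [hr]
    have c1 : ((2 * k - j : ℕ) : ℤ) = 2 * k - j := by omega
    have c2 : (-1 : ℂ) ^ (2 * k - j) = (-1) ^ j := by
      have : (-1 : ℂ) ^ (2 * k - j) * (-1) ^ j = 1 := by
        rw [← pow_add, show 2 * k - j + j = 2 * k by omega]
        simp [pow_mul]
      have hsq : (-1 : ℂ) ^ j * (-1) ^ j = 1 := by rw [← mul_pow]; simp
      linear_combination (-1) ^ j * this - (-1) ^ (2 * k - j) * hsq
    rw [c1, c2,
      show 2 * (j : ℤ) - 1 - ((2 * l + 1 : ℕ) : ℤ) = -(2 * (k : ℤ) - 2 * j) by rw [hk]; push_cast; ring,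
      show 2 * (2 * (k : ℤ) - j) - 1 - ((2 * l + 1 : ℕ) : ℤ) = 2 * (k : ℤ) - 2 * j by
        rw [hk]; push_cast; ring,
      neg_neg, show (2 * (k : ℂ) - 2 * (j : ℂ)) = ((2 * (k : ℤ) - 2 * j : ℤ) : ℂ) by push_cast; ring,
      cosh_int_mul_log ht0, cCoeff, z1, z2,
      show -2 * (k : ℤ) + 2 * (j : ℤ) = -(2 * (k : ℤ) - 2 * j) by ring, bernoulliProd,
      show 2 * (2 * l + 1) + 2 - 2 * j = 4 * k - 2 * j by omega, hp, if_neg hj'.ne]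
    ring
  · rw [show 2 * (k : ℤ) - 1 - ((2 * l + 1 : ℕ) : ℤ) = 0 by rw [hk]; push_cast; ring,
      sub_self, zero_mul, Complex.cosh_zero, cCoeff, z1, z2, if_pos rfl, bernoulliProd,
      show 2 * (2 * l + 1) + 2 - 2 * k = 4 * k - 2 * k by omega, hp,
      show -2 * (k : ℤ) + 2 * (k : ℤ) = 0 by ring, sub_self, neg_zero]
    simp only [zpow_zero]
    ring

/-! ### Formulas for odd powers of `π` -/

/-- By `-x/(1+x) = -x/(1-x) + 2x²/(1-x²)`, the odd terms of `L_{-q} + L_q - 2 L_{q²}` vanish; the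
even ones are again Lambert series, in `q²` and `q⁴`. -/
theorem lambertL_neg {q : ℂ} (hq : ‖q‖ < 1) (s : ℂ) :
    lambertL (-q) s = -lambertL q s + 2 * (1 + 2 ^ s) * lambertL (q ^ 2) s
      - 2 * 2 ^ s * lambertL (q ^ 4) s := by
  have hq2 : ‖q ^ 2‖ < 1 := by
    rw [norm_pow]
    exact pow_lt_one₀ (norm_nonneg _) hq two_ne_zero
  have hq4 : ‖q ^ 4‖ < 1 := by
    rw [norm_pow]
    exact pow_lt_one₀ (norm_nonneg _) hq four_ne_zero
  have h1 := (lambertL_summable hq s).hasSum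
  have h2 := (lambertL_summable hq2 s).hasSum
  have h4 := (lambertL_summable hq4 s).hasSum
  have hm := (lambertL_summable (show ‖-q‖ < 1 by rwa [norm_neg]) s).hasSum
  have hd := hm.sub (h1.neg.add (h2.mul_left 2))
  have he := ((h2.mul_left 2).sub (h4.mul_left 2)).mul_left ((2 : ℂ) ^ s)
  have hne : ∀ n : ℕ, 1 - q ^ (n + 1) ≠ 0 ∧ 1 + q ^ (n + 1) ≠ 0 := by
    intro n
    have h : ‖q ^ (n + 1)‖ < 1 := by
      rw [norm_pow]
      exact pow_lt_one₀ (norm_nonneg _) hq n.succ_ne_zero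
    constructor
    · intro h0
      rw [← sub_eq_zero.1 h0, norm_one] at h
      exact lt_irrefl _ h
    · intro h0
      rw [← neg_eq_of_add_eq_zero_right h0, norm_neg, norm_one] at h
      exact lt_irrefl _ h
  -- The index is shifted by one, so the odd index `2m + 1` stands for the even integer `2(m + 1)`.
  have hinj : Function.Injective fun m : ℕ => 2 * m + 1 := fun a b h => by
    simp only at h
    omega
  rw [← hinj.hasSum_iff] at hd
  · have key := hd.unique (he.congr_fun fun m => ?_)
    · change lambertL (-q) s - (-lambertL q s + 2 * lambertL (q ^ 2) s) =
        2 ^ s * (2 * lambertL (q ^ 2) s - 2 * lambertL (q ^ 4) s) at key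
      linear_combination key
    · have hc : ((2 * m + 1 + 1 : ℕ) : ℂ) ^ s = 2 ^ s * ((m + 1 : ℕ) : ℂ) ^ s := by
        rw [show 2 * m + 1 + 1 = 2 * (m + 1) by ring, Nat.cast_mul,
          Complex.natCast_mul_natCast_cpow, Nat.cast_ofNat]
      have p1 : (-q) ^ (2 * m + 1 + 1) = q ^ (2 * m + 1 + 1) :=
        Even.neg_pow ⟨m + 1, by ring⟩ q
      have p2 : (q ^ 2) ^ (2 * m + 1 + 1) = (q ^ (2 * m + 1 + 1)) ^ 2 := by ring
      have p3 : (q ^ 2) ^ (m + 1) = q ^ (2 * m + 1 + 1) := by ring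
      have p4 : (q ^ 4) ^ (m + 1) = (q ^ (2 * m + 1 + 1)) ^ 2 := by ring
      simp only [Function.comp]
      rw [hc, p1, p2, p3, p4]
      ring
  · intro n hn
    obtain ⟨m, hm⟩ : ∃ m, n = 2 * m := by
      rcases Nat.even_or_odd' n with ⟨m, h | h⟩
      · exact ⟨m, h⟩
      · exact absurd ⟨m, h.symm⟩ hn
    have p1 : (-q) ^ (n + 1) = -q ^ (n + 1) := Odd.neg_pow ⟨m, by rw [hm]⟩ q
    have p2 : (q ^ 2) ^ (n + 1) = (q ^ (n + 1)) ^ 2 := by ring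
    rw [p1, p2]
    obtain ⟨a1, a2⟩ := hne n
    generalize q ^ (n + 1) = x at *
    rw [sub_neg_eq_add, show 1 - x ^ 2 = (1 - x) * (1 + x) by ring]
    field_simp
    ring

theorem bernoulli_four : bernoulli 4 = -1 / 30 := by
  rw [bernoulli_eq_bernoulli'_of_ne_one (by norm_num), bernoulli'_four]

theorem bernoulli'_six : bernoulli' 6 = 1 / 42 := by
  have h := sum_bernoulli' 7
  have h5 : bernoulli' 5 = 0 := bernoulli'_eq_zero_of_odd (by decide) (by norm_num)
  norm_num [Finset.sum_range_succ, h5, Nat.choose] at h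
  linarith

theorem bernoulli_six : bernoulli 6 = 1 / 42 := by
  rw [bernoulli_eq_bernoulli'_of_ne_one (by norm_num), bernoulli'_six]

theorem bernoulli'_eight : bernoulli' 8 = -1 / 30 := by
  have h := sum_bernoulli' 9
  have h5 : bernoulli' 5 = 0 := bernoulli'_eq_zero_of_odd (by decide) (by norm_num)
  have h7 : bernoulli' 7 = 0 := bernoulli'_eq_zero_of_odd (by decide) (by norm_num)
  norm_num [Finset.sum_range_succ, h5, h7, bernoulli'_six, Nat.choose] at h
  linarith

theorem bernoulli_eight : bernoulli 8 = -1 / 30 := by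
  rw [bernoulli_eq_bernoulli'_of_ne_one (by norm_num), bernoulli'_eight]

theorem bernoulli'_ten : bernoulli' 10 = 5 / 66 := by
  have h := sum_bernoulli' 11
  have h5 : bernoulli' 5 = 0 := bernoulli'_eq_zero_of_odd (by decide) (by norm_num)
  have h7 : bernoulli' 7 = 0 := bernoulli'_eq_zero_of_odd (by decide) (by norm_num)
  have h9 : bernoulli' 9 = 0 := bernoulli'_eq_zero_of_odd (by decide) (by norm_num)
  norm_num [Finset.sum_range_succ, h5, h7, h9, bernoulli'_six, bernoulli'_eight, Nat.choose] at h
  linarith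

theorem bernoulli_ten : bernoulli 10 = 5 / 66 := by
  rw [bernoulli_eq_bernoulli'_of_ne_one (by norm_num), bernoulli'_ten]

theorem bernoulli_twelve : bernoulli 12 = -691 / 2730 := by
  rw [bernoulli_eq_bernoulli'_of_ne_one (by norm_num)]
  have h := sum_bernoulli' 13
  have h5 : bernoulli' 5 = 0 := bernoulli'_eq_zero_of_odd (by decide) (by norm_num)
  have h7 : bernoulli' 7 = 0 := bernoulli'_eq_zero_of_odd (by decide) (by norm_num)
  have h9 : bernoulli' 9 = 0 := bernoulli'_eq_zero_of_odd (by decide) (by norm_num)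
  have h11 : bernoulli' 11 = 0 := bernoulli'_eq_zero_of_odd (by decide) (by norm_num)
  norm_num [Finset.sum_range_succ, h5, h7, h9, h11, bernoulli'_six, bernoulli'_eight,
    bernoulli'_ten, Nat.choose] at h
  linarith

/-- Since `t = 1` is fixed by inversion, the two brackets of (2) coincide. -/
theorem lambertL_odd_at_two_one {k : ℕ} (hk : 1 ≤ k) :
    2 * (2 ^ (2 * (k : ℤ) - 1) * lambertL (exp (-Real.pi)) (-(4 * (k : ℂ) - 1))
      - (2 ^ (2 * (k : ℤ) - 1) + 2 ^ (-2 * (k : ℤ) + 1)) *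
        lambertL (exp (-(2 * Real.pi))) (-(4 * (k : ℂ) - 1))
      + 2 ^ (-2 * (k : ℤ) + 1) * lambertL (exp (-(4 * Real.pi))) (-(4 * (k : ℂ) - 1))) =
    (2 * Real.pi) ^ (4 * k - 1) * ∑ j ∈ Finset.range (k + 1),
      (-1) ^ j * cCoeff j k 2 * (bernoulli (2 * j) : ℂ) * (bernoulli (4 * k - 2 * j) : ℂ) /
        ((Nat.factorial (2 * j) : ℂ) * (Nat.factorial (4 * k - 2 * j) : ℂ)) := by
  have h := lambertL_transformation_odd (k - 1) (a := 2) (t := 1) (by norm_num) (by norm_num)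
    (by norm_num) (by norm_num) (k := k) (by omega)
  rw [show -(2 * (Real.pi : ℂ) * 1 / 2) = -Real.pi by ring,
    show -(2 * (Real.pi : ℂ) * 2 * 1) = -(4 * Real.pi) by ring,
    show -(2 * (Real.pi : ℂ) * 1) = -(2 * Real.pi) by ring,
    show -(2 * (Real.pi : ℂ) / (2 * 1)) = -Real.pi by ring,
    show -(2 * (Real.pi : ℂ) / 1) = -(2 * Real.pi) by ring,
    show -(2 * (Real.pi : ℂ) * 2 / 1) = -(4 * Real.pi) by ring] at h
  simp only [one_pow, div_one, one_mul, log_one, mul_zero, cosh_zero, mul_one] at h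
  rw [← h]
  ring

theorem pi_pow_three_eq : (Real.pi : ℂ) ^ 3 = 720 * lambertL (exp (-Real.pi)) (-3)
    - 900 * lambertL (exp (-(2 * Real.pi))) (-3) + 180 * lambertL (exp (-(4 * Real.pi))) (-3) := by
  have h := lambertL_odd_at_two_one (k := 1) le_rfl
  norm_num [Finset.sum_range_succ, cCoeff, bernoulli_four, Nat.factorial, zpow_neg, zpow_ofNat] at h
  linear_combination -180 * h

theorem pi_pow_seven_eq : (Real.pi : ℂ) ^ 7 = 907200 / 13 * lambertL (exp (-Real.pi)) (-7)
    - 70875 * lambertL (exp (-(2 * Real.pi))) (-7)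
    + 14175 / 13 * lambertL (exp (-(4 * Real.pi))) (-7) := by
  have h := lambertL_odd_at_two_one (k := 2) (by norm_num)
  norm_num [Finset.sum_range_succ, cCoeff, bernoulli_four, bernoulli_six, bernoulli_eight,
    Nat.factorial, zpow_neg, zpow_ofNat] at h
  linear_combination -(56700 / 13) * h

theorem pi_pow_eleven_eq : (Real.pi : ℂ) ^ 11 =
    27243216000 / 4009 * lambertL (exp (-Real.pi)) (-11)
    - 218158565625 / 32072 * lambertL (exp (-(2 * Real.pi))) (-11)
    + 212837625 / 32072 * lambertL (exp (-(4 * Real.pi))) (-11) := by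
  have h := lambertL_odd_at_two_one (k := 3) (by norm_num)
  norm_num [Finset.sum_range_succ, cCoeff, bernoulli_four, bernoulli_six, bernoulli_eight,
    bernoulli_ten, bernoulli_twelve, Nat.factorial, zpow_neg, zpow_ofNat] at h
  linear_combination -(425675250 / 4009) * h

theorem exp_neg_two_pi_mul_one_add_I : exp (-(2 * Real.pi * (1 + I))) = exp (-(2 * Real.pi)) := by
  rw [show -(2 * (Real.pi : ℂ) * (1 + I)) = -(2 * Real.pi) - 2 * Real.pi * I by ring,
    Complex.exp_sub, Complex.exp_two_pi_mul_I, div_one]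

theorem inv_one_add_I : (1 + I)⁻¹ = (1 - I) / 2 := by
  refine inv_eq_of_mul_eq_one_right ?_
  linear_combination -(1 / 2) * I_sq

theorem exp_neg_two_pi_mul_inv_one_add_I :
    exp (-(2 * Real.pi * (1 + I)⁻¹)) = -exp (-Real.pi) := by
  rw [inv_one_add_I, show -(2 * (Real.pi : ℂ) * ((1 - I) / 2)) = -Real.pi + Real.pi * I by ring,
    Complex.exp_add, Complex.exp_pi_mul_I, mul_neg_one]

theorem lambertL_neg_exp_neg_pi (s : ℂ) :
    lambertL (-exp (-Real.pi)) s = -lambertL (exp (-Real.pi)) s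
      + 2 * (1 + 2 ^ s) * lambertL (exp (-(2 * Real.pi))) s
      - 2 * 2 ^ s * lambertL (exp (-(4 * Real.pi))) s := by
  have hq : ‖exp (-(Real.pi : ℂ))‖ < 1 := by
    have := norm_exp_neg_two_pi_mul_lt_one (x := 1 / 2) (by norm_num)
    rwa [show -(2 * (Real.pi : ℂ) * (1 / 2)) = -Real.pi by ring] at this
  rw [lambertL_neg hq, ← Complex.exp_nat_mul, ← Complex.exp_nat_mul,
    show ((2 : ℕ) : ℂ) * -Real.pi = -(2 * Real.pi) by push_cast; ring,
    show ((4 : ℕ) : ℂ) * -Real.pi = -(4 * Real.pi) by push_cast; ring]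

theorem ramanujan_formula_two {n : ℕ} (hn : 1 ≤ n) :
    (2 ^ n)⁻¹ * (lambertL (exp (-(4 * Real.pi))) (-(2 * (n : ℂ) + 1)) +
        riemannZeta (2 * n + 1 : ℕ) / 2)
      - (-2) ^ n * (lambertL (exp (-Real.pi)) (-(2 * (n : ℂ) + 1)) +
        riemannZeta (2 * n + 1 : ℕ) / 2) = ramanujanSum n 2 := by
  have h := ramanujan_formula hn (t := 2) (by norm_num)
  rwa [show -(2 * (Real.pi : ℂ) * 2) = -(4 * Real.pi) by ring,
    show -(2 * (Real.pi : ℂ) * 2⁻¹) = -Real.pi by ring] at h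

/-- At `t = 1 + i` the nomes are `e^{-2π}` and `-e^{-π}`; `lambertL_neg` reduces the latter to the
three nomes wanted, giving a relation besides the one at `t = 2`. -/
theorem ramanujan_formula_one_add_I {n : ℕ} (hn : 1 ≤ n) :
    ((1 + I) ^ n)⁻¹ * (lambertL (exp (-(2 * Real.pi))) (-(2 * (n : ℂ) + 1)) +
        riemannZeta (2 * n + 1 : ℕ) / 2)
      - (-(1 + I)) ^ n * (-lambertL (exp (-Real.pi)) (-(2 * (n : ℂ) + 1))
        + 2 * (1 + 2 ^ (-(2 * (n : ℂ) + 1))) *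
          lambertL (exp (-(2 * Real.pi))) (-(2 * (n : ℂ) + 1))
        - 2 * 2 ^ (-(2 * (n : ℂ) + 1)) * lambertL (exp (-(4 * Real.pi))) (-(2 * (n : ℂ) + 1)) +
        riemannZeta (2 * n + 1 : ℕ) / 2) = ramanujanSum n (1 + I) := by
  have h := ramanujan_formula hn (t := 1 + I) (by norm_num)
  rwa [exp_neg_two_pi_mul_one_add_I, exp_neg_two_pi_mul_inv_one_add_I,
    lambertL_neg_exp_neg_pi] at h

theorem log_one_add_I : 2 * log (1 + I) = Real.log 2 + Real.pi / 2 * I := by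
  have h0 : (1 + I) ≠ 0 := fun h => by simpa using congrArg re h
  have ha := abs_lt.1 (abs_arg_lt_pi_div_two_iff.2 (Or.inl (show 0 < (1 + I).re by norm_num)))
  have h := (log_mul_eq_add_log_iff h0 h0).2 ⟨by linarith, by linarith⟩
  rw [show (1 + I) * (1 + I) = ((2 : ℝ) : ℂ) * I by push_cast; linear_combination I_sq,
    Complex.log_ofReal_mul two_pos I_ne_zero, log_I] at h
  rw [two_mul, ← h]

theorem pi_eq : (Real.pi : ℂ) = 72 * lambertL (exp (-Real.pi)) (-1)
    - 96 * lambertL (exp (-(2 * Real.pi))) (-1) + 24 * lambertL (exp (-(4 * Real.pi))) (-1) := by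
  have h1 := lambertL_neg_one_sub (t := 2) (by norm_num)
  rw [show -(2 * (Real.pi : ℂ) * 2) = -(4 * Real.pi) by ring,
    show -(2 * (Real.pi : ℂ) * 2⁻¹) = -Real.pi by ring,
    show log 2 = (Real.log 2 : ℂ) by rw [Complex.ofReal_log two_pos.le]; simp] at h1
  have h2 := lambertL_neg_one_sub (t := 1 + I) (by norm_num)
  rw [exp_neg_two_pi_mul_one_add_I, exp_neg_two_pi_mul_inv_one_add_I,
    lambertL_neg_exp_neg_pi, inv_one_add_I, cpow_neg_one] at h2
  -- The weights cancel `log 2`, because `2 log (1 + i) = log 2 + π i / 2`; the imaginary parts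
  -- cancel too.
  linear_combination 24 * h1 - 48 * h2 - 12 * log_one_add_I

theorem pi_pow_five_eq : (Real.pi : ℂ) ^ 5 = 7056 * lambertL (exp (-Real.pi)) (-5)
    - 6993 * lambertL (exp (-(2 * Real.pi))) (-5) - 63 * lambertL (exp (-(4 * Real.pi))) (-5) := by
  have h1 := ramanujan_formula_two (n := 2) (by norm_num)
  have h2 := ramanujan_formula_one_add_I (n := 2) (by norm_num)
  have s : -(2 * ((2 : ℕ) : ℂ) + 1) = -5 := by norm_num
  have c : (2 : ℂ) ^ (-5 : ℂ) = 1 / 32 := by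
    rw [cpow_neg, show (5 : ℂ) = ((5 : ℕ) : ℂ) by norm_num, cpow_natCast]
    norm_num
  have i2 : (1 + I) ^ 2 = 2 * I := by linear_combination I_sq
  have i3 : (1 + I) ^ 3 = -2 + 2 * I := by linear_combination (3 + I) * I_sq
  have j3 : (-2 + 2 * I)⁻¹ = -(1 + I) / 4 :=
    inv_eq_of_mul_eq_one_right (by linear_combination -(1 / 2) * I_sq)
  rw [s] at h1 h2
  rw [c, neg_pow, i2, mul_inv, inv_I] at h2
  simp only [ramanujanSum, bernoulliProd, Finset.sum_range_succ, Finset.sum_range_zero] at h1 h2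
  norm_num [bernoulli_four, bernoulli_six, Nat.factorial, zpow_neg, zpow_ofNat,
    inv_one_add_I, i3, j3] at h1 h2
  have h3 : 1 / 2 * (lambertL (exp (-(2 * Real.pi))) (-5) + riemannZeta 5 / 2) +
      2 * (-lambertL (exp (-Real.pi)) (-5) + 33 / 16 * lambertL (exp (-(2 * Real.pi))) (-5) -
        1 / 16 * lambertL (exp (-(4 * Real.pi))) (-5) + riemannZeta 5 / 2) =
      Real.pi ^ 5 / 252 := by
    refine mul_left_cancel₀ I_ne_zero ?_
    linear_combination -h2
  -- `ζ(5)` has coefficient `-15/8` in `h1` and `5/4` in `h3`, so the ratio `2 : 3` removes it.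
  linear_combination 1008 * h1 + 1512 * h3

theorem pi_pow_nine_eq : (Real.pi : ℂ) ^ 9 = 28226880 / 41 * lambertL (exp (-Real.pi)) (-9)
    - 112920885 / 164 * lambertL (exp (-(2 * Real.pi))) (-9)
    + 13365 / 164 * lambertL (exp (-(4 * Real.pi))) (-9) := by
  have h1 := ramanujan_formula_two (n := 4) (by norm_num)
  have h2 := ramanujan_formula_one_add_I (n := 4) (by norm_num)
  have s : -(2 * ((4 : ℕ) : ℂ) + 1) = -9 := by norm_num
  have c : (2 : ℂ) ^ (-9 : ℂ) = 1 / 512 := by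
    rw [cpow_neg, show (9 : ℂ) = ((9 : ℕ) : ℂ) by norm_num, cpow_natCast]
    norm_num
  have i2 : (1 + I) ^ 2 = 2 * I := by linear_combination I_sq
  have i3 : (1 + I) ^ 3 = -2 + 2 * I := by linear_combination (3 + I) * I_sq
  have i4 : (1 + I) ^ 4 = -4 := by linear_combination ((1 + I) ^ 2 + 2 * I) * i2 + 4 * I_sq
  have i5 : (1 + I) ^ 5 = -4 - 4 * I := by linear_combination (1 + I) * i4
  have j3 : (-2 + 2 * I)⁻¹ = -(1 + I) / 4 :=
    inv_eq_of_mul_eq_one_right (by linear_combination -(1 / 2) * I_sq)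
  have j5 : (-4 - 4 * I)⁻¹ = -(1 - I) / 8 :=
    inv_eq_of_mul_eq_one_right (by linear_combination -(1 / 2) * I_sq)
  rw [s] at h1 h2
  rw [c, neg_pow, i4] at h2
  simp only [ramanujanSum, bernoulliProd, Finset.sum_range_succ, Finset.sum_range_zero] at h1 h2
  norm_num [bernoulli_four, bernoulli_six, bernoulli_eight, bernoulli_ten, Nat.factorial,
    zpow_neg, zpow_ofNat, inv_one_add_I, i3, j3, i5, j5] at h1 h2
  -- The ratio `4 : 17` removes `ζ(9)`, whose coefficients are `-255/32` and `15/8`.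
  linear_combination (213840 * 4 / 41) * h1 + (213840 * 17 / 41) * h2

end

theorem mainTheorem10 :
    -- the transformation laws
    (∀ a t : ℂ, 0 < a.re → 0 < t.re → 0 < (a * t).re → 0 < (t / a).re →
      -- (1): `s = -(4k+1) = -1, -5, -9, …`
      (∀ k : ℕ,
        1 / t ^ (2 * k) *
            (a ^ (2 * (k : ℤ)) *
                lambertL (Complex.exp (-(2 * Real.pi * t / a))) (-(4 * (k : ℂ) + 1))
              - (a ^ (2 * (k : ℤ)) + a ^ (-2 * (k : ℤ))) *
                lambertL (Complex.exp (-(2 * Real.pi * t))) (-(4 * (k : ℂ) + 1))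
              + a ^ (-2 * (k : ℤ)) *
                lambertL (Complex.exp (-(2 * Real.pi * a * t))) (-(4 * (k : ℂ) + 1)))
          - t ^ (2 * k) *
            (a ^ (2 * (k : ℤ)) *
                lambertL (Complex.exp (-(2 * Real.pi / (a * t)))) (-(4 * (k : ℂ) + 1))
              - (a ^ (2 * (k : ℤ)) + a ^ (-2 * (k : ℤ))) *
                lambertL (Complex.exp (-(2 * Real.pi / t))) (-(4 * (k : ℂ) + 1))
              + a ^ (-2 * (k : ℤ)) *
                lambertL (Complex.exp (-(2 * Real.pi * a / t))) (-(4 * (k : ℂ) + 1)))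
        = (2 * Real.pi) ^ (4 * k + 1) *
            ∑ j ∈ Finset.range (k + 1),
              (-1) ^ j * bCoeff j k a * (bernoulli (2 * j) : ℂ) *
                  (bernoulli (4 * k + 2 - 2 * j) : ℂ) *
                  Complex.sinh ((2 * (k : ℂ) + 1 - 2 * (j : ℂ)) * Complex.log t)
                / ((Nat.factorial (2 * j) : ℂ) * (Nat.factorial (4 * k + 2 - 2 * j) : ℂ))) ∧
      -- (2): `s = -(4k-1) = -3, -7, -11, …`
      (∀ k : ℕ, 1 ≤ k →
        1 / t ^ (2 * k - 1) *
            (a ^ (2 * (k : ℤ) - 1) *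
                lambertL (Complex.exp (-(2 * Real.pi * t / a))) (-(4 * (k : ℂ) - 1))
              - (a ^ (2 * (k : ℤ) - 1) + a ^ (-2 * (k : ℤ) + 1)) *
                lambertL (Complex.exp (-(2 * Real.pi * t))) (-(4 * (k : ℂ) - 1))
              + a ^ (-2 * (k : ℤ) + 1) *
                lambertL (Complex.exp (-(2 * Real.pi * a * t))) (-(4 * (k : ℂ) - 1)))
          + t ^ (2 * k - 1) *
            (a ^ (2 * (k : ℤ) - 1) *
                lambertL (Complex.exp (-(2 * Real.pi / (a * t)))) (-(4 * (k : ℂ) - 1))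
              - (a ^ (2 * (k : ℤ) - 1) + a ^ (-2 * (k : ℤ) + 1)) *
                lambertL (Complex.exp (-(2 * Real.pi / t))) (-(4 * (k : ℂ) - 1))
              + a ^ (-2 * (k : ℤ) + 1) *
                lambertL (Complex.exp (-(2 * Real.pi * a / t))) (-(4 * (k : ℂ) - 1)))
        = (2 * Real.pi) ^ (4 * k - 1) *
            ∑ j ∈ Finset.range (k + 1),
              (-1) ^ j * cCoeff j k a * (bernoulli (2 * j) : ℂ) *
                  (bernoulli (4 * k - 2 * j) : ℂ) *
                  Complex.cosh ((2 * (k : ℂ) - 2 * (j : ℂ)) * Complex.log t)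
                / ((Nat.factorial (2 * j) : ℂ) * (Nat.factorial (4 * k - 2 * j) : ℂ)))) ∧
    -- the resulting formulas for odd powers of `π`
    ((Real.pi : ℂ) = 72 * lambertL (Complex.exp (-Real.pi)) (-1)
        - 96 * lambertL (Complex.exp (-(2 * Real.pi))) (-1)
        + 24 * lambertL (Complex.exp (-(4 * Real.pi))) (-1)) ∧
    ((Real.pi : ℂ) ^ 5 = 7056 * lambertL (Complex.exp (-Real.pi)) (-5)
        - 6993 * lambertL (Complex.exp (-(2 * Real.pi))) (-5)
        - 63 * lambertL (Complex.exp (-(4 * Real.pi))) (-5)) ∧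
    ((Real.pi : ℂ) ^ 9 = 28226880 / 41 * lambertL (Complex.exp (-Real.pi)) (-9)
        - 112920885 / 164 * lambertL (Complex.exp (-(2 * Real.pi))) (-9)
        + 13365 / 164 * lambertL (Complex.exp (-(4 * Real.pi))) (-9)) ∧
    ((Real.pi : ℂ) ^ 3 = 720 * lambertL (Complex.exp (-Real.pi)) (-3)
        - 900 * lambertL (Complex.exp (-(2 * Real.pi))) (-3)
        + 180 * lambertL (Complex.exp (-(4 * Real.pi))) (-3)) ∧
    ((Real.pi : ℂ) ^ 7 = 907200 / 13 * lambertL (Complex.exp (-Real.pi)) (-7)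
        - 70875 * lambertL (Complex.exp (-(2 * Real.pi))) (-7)
        + 14175 / 13 * lambertL (Complex.exp (-(4 * Real.pi))) (-7)) ∧
    ((Real.pi : ℂ) ^ 11 = 27243216000 / 4009 * lambertL (Complex.exp (-Real.pi)) (-11)
        - 218158565625 / 32072 * lambertL (Complex.exp (-(2 * Real.pi))) (-11)
        + 212837625 / 32072 * lambertL (Complex.exp (-(4 * Real.pi))) (-11)) := by
  refine ⟨fun a t ha ht hat hta => ⟨fun k => lambertL_transformation_even k ha ht hat hta,
    fun k hk => lambertL_transformation_odd (k - 1) ha ht hat hta (by omega)⟩,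
    pi_eq, pi_pow_five_eq, pi_pow_nine_eq, pi_pow_three_eq, pi_pow_seven_eq, pi_pow_eleven_eq⟩
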